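/- For integers $i, j$ with $0 \le j < i$, let the Eulerian number $A(i,j)$ be the number of permutations $\sigma$ of $\{1,\dots,i\}$ with exactly $j$ ascents, that is, with exactly $j$ indices $1 \le k < i$ such that $\sigma(k) < \sigma(k+1)$. Then there is an integer $M \ge 3$ such that for all integers $m \ge M$, $$A(2m-1,m-1) - 2A(2m-1,m-2) + A(2m-1,m-3) < 0.$$ -/

import Mathlib

/-- The number of ascents of a permutation `σ` of `{0, …, n - 1}`: the number of positions `i`
such that `i + 1` is also a position and `σ i < σ (i + 1)`. -/
def ascentCount {n : ℕ} (σ : Equiv.Perm (Fin n)) : ℕ :=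
  (Finset.univ.filter fun i : Fin n => ∃ h : (i : ℕ) + 1 < n, σ i < σ ⟨(i : ℕ) + 1, h⟩).card

/-- The Eulerian number `A(n, j)`: the number of permutations of a set of `n` elements that have
exactly `j` ascents. -/
def eulerianNumber (n j : ℕ) : ℕ :=
  (Finset.univ.filter fun σ : Equiv.Perm (Fin n) => ascentCount σ = j).card

/-! Inserting a new maximum into a permutation adds one ascent or none, which gives A(n+1,j) =
(j+1)A(n,j) + (n+1-j)A(n,j-1). Symmetry and monotonicity up to the middle follow by induction on the
row. The second difference is handled by induction over odd rows. Let a, b, c, d be the entries of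
an odd row from the centre leftwards. Two steps of the recurrence express the next odd row's second
difference in them (`second_difference_step`); a + c < 2b and d ≤ c ≤ b keep it negative. The base
case is row 9. -/

/-! ### Inserting a maximum into a sequence -/

/-- The number of indices `i < k` at which a sequence of natural numbers ascends. -/
def sequenceAscents (f : ℕ → ℕ) (k : ℕ) : ℕ :=
  ∑ i ∈ Finset.range k, if f i < f (i + 1) then 1 else 0

/-- The sequence obtained by inserting the value `N` at position `p`. -/
def insertValue (f : ℕ → ℕ) (p N : ℕ) (i : ℕ) : ℕ :=
  if i < p then f i else if i = p then N else f (i - 1)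

/-- Inserting a maximum at position `p` creates a new ascent (`1`) or does not (`0`). -/
def insertionGain (f : ℕ → ℕ) (k : ℕ) : ℕ → ℕ
  | 0 => 0
  | q + 1 => if q < k ∧ f q < f (q + 1) then 0 else 1

theorem insertionGain_le_one (f : ℕ → ℕ) (k p : ℕ) : insertionGain f k p ≤ 1 := by
  cases p with
  | zero => simp [insertionGain]
  | succ q => simp only [insertionGain]; split_ifs <;> omega

theorem sequenceAscents_le (f : ℕ → ℕ) (k : ℕ) : sequenceAscents f k ≤ k := by
  unfold sequenceAscents
  rw [← Finset.card_filter]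
  exact (Finset.card_filter_le _ _).trans_eq (Finset.card_range k)

theorem sequenceAscents_insertValue (f : ℕ → ℕ) (k p N : ℕ) (hp : p ≤ k + 1)
    (hN : ∀ i ≤ k, f i < N) :
    sequenceAscents (insertValue f p N) (k + 1) = sequenceAscents f k + insertionGain f k p := by
  unfold sequenceAscents
  cases p with
  | zero =>
    rw [Finset.sum_range_succ']
    have h : ¬ N < f 0 := by have := hN 0 (Nat.zero_le k); omega
    simp [insertValue, insertionGain, h]
  | succ q =>
    have hlow : ∀ i ∈ Finset.range q,
        (if insertValue f (q + 1) N i < insertValue f (q + 1) N (i + 1) then 1 else 0)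
          = if f i < f (i + 1) then 1 else 0 := by
      intro i hi
      have hi := Finset.mem_range.1 hi
      simp [insertValue, hi, Nat.lt_succ_of_lt hi]
    have hmid : insertValue f (q + 1) N q < insertValue f (q + 1) N (q + 1) := by
      simpa [insertValue] using hN q (by omega)
    rcases Nat.lt_or_ge q k with hq | hq
    · obtain ⟨r, rfl⟩ : ∃ r, k = q + 1 + r := ⟨k - (q + 1), by omega⟩
      have hfall : ¬ insertValue f (q + 1) N (q + 1) < insertValue f (q + 1) N (q + 1 + 1) := by
        have := hN (q + 1) (by omega)
        simp [insertValue]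
        omega
      have hhigh : ∀ i ∈ Finset.range r,
          (if insertValue f (q + 1) N (q + 1 + 1 + i) < insertValue f (q + 1) N (q + 1 + 1 + i + 1)
            then 1 else 0) = if f (q + 1 + i) < f (q + 1 + i + 1) then 1 else 0 := by
        intro i _
        have h1 : insertValue f (q + 1) N (q + 1 + 1 + i) = f (q + 1 + i) := by
          rw [insertValue, if_neg (by omega), if_neg (by omega)]; congr 1; omega
        have h2 : insertValue f (q + 1) N (q + 1 + 1 + i + 1) = f (q + 1 + i + 1) := by
          rw [insertValue, if_neg (by omega), if_neg (by omega)]; congr 1; omega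
        rw [h1, h2]
      rw [show q + 1 + r + 1 = q + 1 + 1 + r by omega, Finset.sum_range_add,
        Finset.sum_range_add _ (q + 1) r,
        Finset.sum_range_succ, Finset.sum_range_succ, Finset.sum_range_succ,
        Finset.sum_congr rfl hlow, Finset.sum_congr rfl hhigh, if_pos hmid, if_neg hfall]
      simp only [insertionGain, hq, true_and]
      split_ifs <;> omega
    · obtain rfl : q = k := by omega
      rw [Finset.sum_range_succ, Finset.sum_congr rfl hlow, if_pos hmid]
      simp [insertionGain]

/-- The slots without gain are the front and the gaps at ascents. -/
theorem sum_one_sub_insertionGain (f : ℕ → ℕ) (k : ℕ) :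
    ∑ p ∈ Finset.range (k + 2), (1 - insertionGain f k p) = sequenceAscents f k + 1 := by
  rw [Finset.sum_range_succ', Finset.sum_range_succ]
  simp only [insertionGain, lt_irrefl, false_and, if_false, Nat.sub_self, add_zero, sequenceAscents]
  congr 1
  refine Finset.sum_congr rfl fun i hi => ?_
  simp only [Finset.mem_range.1 hi, true_and]
  split_ifs <;> rfl

theorem sum_insertionGain (f : ℕ → ℕ) (k : ℕ) :
    ∑ p ∈ Finset.range (k + 2), insertionGain f k p = k + 1 - sequenceAscents f k := by
  have h : ∑ p ∈ Finset.range (k + 2), ((1 - insertionGain f k p) + insertionGain f k p) = k + 2 := by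
    rw [Finset.sum_congr rfl fun p _ => Nat.sub_add_cancel (insertionGain_le_one f k p)]
    simp
  rw [Finset.sum_add_distrib, sum_one_sub_insertionGain] at h
  omega

/-! ### Inserting a maximum into a permutation -/

/-- The values of a permutation, extended by zero to a sequence. -/
def permSequence {n : ℕ} (σ : Equiv.Perm (Fin n)) (i : ℕ) : ℕ :=
  if h : i < n then (σ ⟨i, h⟩ : ℕ) else 0

theorem ascentCount_eq_sequenceAscents {k : ℕ} (σ : Equiv.Perm (Fin (k + 1))) :
    ascentCount σ = sequenceAscents (permSequence σ) k := by
  unfold ascentCount sequenceAscents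
  rw [Finset.card_filter, Fin.sum_univ_castSucc, Finset.sum_range]
  simp only [Fin.val_last, lt_irrefl, IsEmpty.exists_iff, if_false, add_zero]
  refine Finset.sum_congr rfl fun i _ => ?_
  have h1 : (i : ℕ) + 1 < k + 1 := by omega
  have h2 : (i : ℕ) < k + 1 := by omega
  rw [permSequence, permSequence, dif_pos h1, dif_pos h2]
  exact if_congr ⟨fun ⟨_, h⟩ => h, fun h => ⟨h1, h⟩⟩ rfl rfl

/-- Insert a new maximum at position `p` into a permutation in one-line notation. -/
def insertMax {n : ℕ} (p : Fin (n + 1)) (σ : Equiv.Perm (Fin n)) : Equiv.Perm (Fin (n + 1)) :=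
  ((finSuccEquiv' p).trans (Equiv.optionCongr σ)).trans (finSuccEquiv' (Fin.last n)).symm

theorem insertMax_self {n : ℕ} (p : Fin (n + 1)) (σ : Equiv.Perm (Fin n)) :
    insertMax p σ p = Fin.last n := by
  simp [insertMax]

theorem insertMax_succAbove {n : ℕ} (p : Fin (n + 1)) (σ : Equiv.Perm (Fin n)) (i : Fin n) :
    insertMax p σ (p.succAbove i) = (σ i).castSucc := by
  simp [insertMax]

theorem insertMax_bijective (n : ℕ) :
    Function.Bijective fun x : Fin (n + 1) × Equiv.Perm (Fin n) => insertMax x.1 x.2 := by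
  rw [Fintype.bijective_iff_injective_and_card]
  constructor
  · rintro ⟨p, σ⟩ ⟨q, τ⟩ h
    have h : insertMax p σ = insertMax q τ := h
    obtain rfl : p = q := by
      apply (insertMax q τ).injective
      rw [insertMax_self, ← h, insertMax_self]
    obtain rfl : σ = τ := by
      ext i
      have := congrArg (fun e => (e (p.succAbove i) : ℕ)) h
      simpa [insertMax_succAbove] using this
    rfl
  · simp [Fintype.card_perm, Nat.factorial_succ]

theorem permSequence_insertMax {n : ℕ} (p : Fin (n + 1)) (σ : Equiv.Perm (Fin n)) {i : ℕ}
    (hi : i < n + 1) :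
    permSequence (insertMax p σ) i = insertValue (permSequence σ) p n i := by
  rw [permSequence, dif_pos hi, insertValue]
  split_ifs with h1 h2
  · have hn : i < n := by omega
    have : (⟨i, hi⟩ : Fin (n + 1)) = p.succAbove ⟨i, hn⟩ := by
      rw [Fin.succAbove_of_castSucc_lt _ _ (by simpa [Fin.lt_def] using h1)]; rfl
    rw [this, insertMax_succAbove, permSequence, dif_pos hn]; rfl
  · have : (⟨i, hi⟩ : Fin (n + 1)) = p := Fin.ext h2
    rw [this, insertMax_self]; rfl
  · have hn : i - 1 < n := by omega
    have : (⟨i, hi⟩ : Fin (n + 1)) = p.succAbove ⟨i - 1, hn⟩ := by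
      rw [Fin.succAbove_of_le_castSucc _ _ (by simp [Fin.le_def]; omega)]
      ext; simp; omega
    rw [this, insertMax_succAbove, permSequence, dif_pos hn]; rfl

theorem ascentCount_insertMax {k : ℕ} (p : Fin (k + 2)) (σ : Equiv.Perm (Fin (k + 1))) :
    ascentCount (insertMax p σ) = ascentCount σ + insertionGain (permSequence σ) k p := by
  rw [ascentCount_eq_sequenceAscents, ascentCount_eq_sequenceAscents,
    ← sequenceAscents_insertValue (permSequence σ) k p (k + 1) (by omega)]
  · refine Finset.sum_congr rfl fun i hi => ?_
    have hi := Finset.mem_range.1 hi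
    rw [permSequence_insertMax p σ (by omega), permSequence_insertMax p σ (by omega)]
  · intro i hi
    rw [permSequence, dif_pos (by omega)]
    exact (σ _).isLt

theorem sum_ascentCount_insertMax {k : ℕ} (σ : Equiv.Perm (Fin (k + 1))) (j : ℕ) :
    (∑ p : Fin (k + 2), if ascentCount (insertMax p σ) = j then 1 else 0)
      = (if ascentCount σ = j then j + 1 else 0)
        + (if ascentCount σ + 1 = j then k + 2 - j else 0) := by
  have h1 := sum_one_sub_insertionGain (permSequence σ) k
  have h2 := sum_insertionGain (permSequence σ) k
  rw [← ascentCount_eq_sequenceAscents] at h1 h2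
  simp only [ascentCount_insertMax]
  rw [← Finset.sum_range
    (fun p => if ascentCount σ + insertionGain (permSequence σ) k p = j then 1 else 0)]
  have key : ∀ p, (if ascentCount σ + insertionGain (permSequence σ) k p = j then 1 else 0)
      = (if ascentCount σ = j then 1 - insertionGain (permSequence σ) k p else 0)
        + (if ascentCount σ + 1 = j then insertionGain (permSequence σ) k p else 0) := by
    intro p
    have := insertionGain_le_one (permSequence σ) k p
    split_ifs <;> omega
  rw [Finset.sum_congr rfl fun p _ => key p, Finset.sum_add_distrib]
  congr 1
  · split_ifs with h
    · rw [h1, h]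
    · simp
  · split_ifs with h
    · rw [h2]; omega
    · simp

/-! ### Recurrence, symmetry and monotonicity of Eulerian numbers -/

theorem eulerianNumber_add_two (k j : ℕ) :
    eulerianNumber (k + 2) j = (j + 1) * eulerianNumber (k + 1) j
      + (k + 2 - j) * (Finset.univ.filter fun σ : Equiv.Perm (Fin (k + 1)) =>
          ascentCount σ + 1 = j).card := by
  simp only [eulerianNumber, Finset.card_filter]
  rw [← Fintype.sum_bijective _ (insertMax_bijective (k + 1)) _ _ fun _ => rfl,
    Fintype.sum_prod_type_right]
  simp only [sum_ascentCount_insertMax, Finset.sum_add_distrib, Finset.mul_sum, mul_ite, mul_one,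
    mul_zero]

theorem eulerianNumber_add_two_zero (k : ℕ) :
    eulerianNumber (k + 2) 0 = eulerianNumber (k + 1) 0 := by
  simp [eulerianNumber_add_two]

theorem eulerianNumber_add_two_succ (k j : ℕ) :
    eulerianNumber (k + 2) (j + 1) = (j + 2) * eulerianNumber (k + 1) (j + 1)
      + (k + 1 - j) * eulerianNumber (k + 1) j := by
  rw [eulerianNumber_add_two, Nat.add_sub_add_right k.succ 1 j]
  simp [eulerianNumber]

theorem eulerianNumber_one_zero : eulerianNumber 1 0 = 1 := by decide

theorem eulerianNumber_eq_zero {n j : ℕ} (h : n ≤ j) : eulerianNumber (n + 1) (j + 1) = 0 := by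
  rw [eulerianNumber, Finset.card_eq_zero, Finset.filter_eq_empty_iff]
  intro σ _ hσ
  rw [ascentCount_eq_sequenceAscents] at hσ
  have := sequenceAscents_le (permSequence σ) n
  omega

/-- Reflecting the row exchanges the two terms of the recurrence together with their weights. -/
theorem eulerianNumber_symm (n : ℕ) : ∀ i j, i + j = n →
    eulerianNumber (n + 1) i = eulerianNumber (n + 1) j := by
  induction n with
  | zero =>
    intro i j h
    obtain rfl : i = 0 := by omega
    obtain rfl : j = 0 := by omega
    rfl
  | succ n ih =>
    have hz : eulerianNumber (n + 2) 0 = eulerianNumber (n + 2) (n + 1) := by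
      rw [eulerianNumber_add_two_zero, eulerianNumber_add_two_succ, eulerianNumber_eq_zero le_rfl,
        ih 0 n (by omega)]
      simp
    intro i j h
    rcases i with _ | i
    · obtain rfl : j = n + 1 := by omega
      exact hz
    rcases j with _ | j
    · obtain rfl : i = n := by omega
      exact hz.symm
    rw [eulerianNumber_add_two_succ, eulerianNumber_add_two_succ, ih (i + 1) j (by omega),
      ih i (j + 1) (by omega), show n + 1 - i = j + 2 by omega, show n + 1 - j = i + 2 by omega]
    ring

theorem eulerianNumber_le_succ (n : ℕ) : ∀ j, 2 * j + 1 ≤ n →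
    eulerianNumber (n + 1) j ≤ eulerianNumber (n + 1) (j + 1) := by
  induction n with
  | zero => intro j h; omega
  | succ n ih =>
    intro j h
    -- If 2j + 1 = n + 1, the two entries are the middle pair, equal by symmetry.
    rcases Nat.lt_or_ge n (2 * j + 1) with hn | hn
    · exact (eulerianNumber_symm (n + 1) j (j + 1) (by omega)).le
    have h1 := ih j hn
    rcases j with _ | j
    · rw [eulerianNumber_add_two_zero, eulerianNumber_add_two_succ]
      nlinarith
    have h0 := ih j (by omega)
    rw [eulerianNumber_add_two_succ, eulerianNumber_add_two_succ]
    obtain ⟨r, rfl⟩ : ∃ r, n = j + 1 + r := ⟨n - (j + 1), by omega⟩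
    rw [show j + 1 + r + 1 - (j + 1) = r + 1 by omega, show j + 1 + r + 1 - j = r + 2 by omega]
    -- With e₀ ≤ e₁ ≤ e₂ the entries j, j+1, j+2 of row n+1, the difference is (j+3)(e₂-e₁) +
    -- (r+2)(e₁-e₀).
    nlinarith

/-- Passing the indices through equations avoids truncated subtraction when rewriting. -/
theorem eulerianNumber_recurrence {N n j i r : ℕ} (hN : N = n + 1) (hn : 0 < n) (hj : j = i + 1)
    (hr : n = i + r) :
    eulerianNumber N j = (j + 1) * eulerianNumber n j + r * eulerianNumber n i := by
  obtain ⟨k, rfl⟩ : ∃ k, n = k + 1 := ⟨n - 1, by omega⟩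
  subst hN hj
  rw [eulerianNumber_add_two_succ, hr, Nat.add_sub_cancel_left]

/-! ### The central second difference -/

/-- Two steps of the Eulerian recurrence preserve negativity of the second difference. -/
theorem second_difference_step {s a b c d : ℕ} (hdc : d ≤ c) (hcb : c ≤ b) (h : a + c < 2 * b) :
    2 * (s + 6) * ((s + 5) * a + (s + 6) * b)
        + ((s + 4) * ((s + 4) * b + (s + 7) * c) + (s + 8) * ((s + 3) * c + (s + 8) * d))
      < 2 * ((s + 5) * ((s + 5) * a + (s + 6) * b) + (s + 7) * ((s + 4) * b + (s + 7) * c)) := by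
  obtain ⟨x, rfl⟩ := Nat.exists_eq_add_of_le hdc
  obtain ⟨y, rfl⟩ := Nat.exists_eq_add_of_le hcb
  -- The right side minus the left contains a with coefficient -2(s+5). Using a ≤ 2b-c-1 there
  -- leaves at least (s²+8s+8)y + (s+8)²x + 2(s+5) > 0.
  have ha : a + 1 ≤ d + x + 2 * y := by omega
  have := Nat.mul_le_mul_left (2 * (s + 5)) ha
  nlinarith [Nat.zero_le (s * s * y), Nat.zero_le (s * s * x), Nat.zero_le (s * x),
    Nat.zero_le (s * y)]

theorem eulerianNumber_central_second_difference_nine :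
    eulerianNumber 9 4 + eulerianNumber 9 2 < 2 * eulerianNumber 9 3 := by
  have row_zero : ∀ n, eulerianNumber (n + 1) 0 = 1 := by
    intro n
    induction n with
    | zero => exact eulerianNumber_one_zero
    | succ n ih => rw [eulerianNumber_add_two_zero, ih]
  have step : ∀ {n j r u v w : ℕ}, 0 < n → eulerianNumber n (j + 1) = u → eulerianNumber n j = v →
      n = j + r → (j + 2) * u + r * v = w → eulerianNumber (n + 1) (j + 1) = w := by
    intro n j r u v w hn hu hv hr hw
    rw [eulerianNumber_recurrence rfl hn rfl hr, hu, hv, ← hw]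
  have a11 : eulerianNumber 1 1 = 0 := eulerianNumber_eq_zero (n := 0) (j := 0) le_rfl
  have a21 : eulerianNumber 2 1 = 1 :=
    step (n := 1) (j := 0) (r := 1) (by norm_num) a11 (row_zero 0) rfl rfl
  have a31 : eulerianNumber 3 1 = 4 :=
    step (n := 2) (j := 0) (r := 2) (by norm_num) a21 (row_zero 1) rfl rfl
  have a41 : eulerianNumber 4 1 = 11 :=
    step (n := 3) (j := 0) (r := 3) (by norm_num) a31 (row_zero 2) rfl rfl
  have a51 : eulerianNumber 5 1 = 26 :=
    step (n := 4) (j := 0) (r := 4) (by norm_num) a41 (row_zero 3) rfl rfl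
  have a61 : eulerianNumber 6 1 = 57 :=
    step (n := 5) (j := 0) (r := 5) (by norm_num) a51 (row_zero 4) rfl rfl
  have a71 : eulerianNumber 7 1 = 120 :=
    step (n := 6) (j := 0) (r := 6) (by norm_num) a61 (row_zero 5) rfl rfl
  have a81 : eulerianNumber 8 1 = 247 :=
    step (n := 7) (j := 0) (r := 7) (by norm_num) a71 (row_zero 6) rfl rfl
  have a22 : eulerianNumber 2 2 = 0 := eulerianNumber_eq_zero (n := 1) (j := 1) le_rfl
  have a32 : eulerianNumber 3 2 = 1 :=
    step (n := 2) (j := 1) (r := 1) (by norm_num) a22 a21 rfl rfl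
  have a42 : eulerianNumber 4 2 = 11 :=
    step (n := 3) (j := 1) (r := 2) (by norm_num) a32 a31 rfl rfl
  have a52 : eulerianNumber 5 2 = 66 :=
    step (n := 4) (j := 1) (r := 3) (by norm_num) a42 a41 rfl rfl
  have a62 : eulerianNumber 6 2 = 302 :=
    step (n := 5) (j := 1) (r := 4) (by norm_num) a52 a51 rfl rfl
  have a72 : eulerianNumber 7 2 = 1191 :=
    step (n := 6) (j := 1) (r := 5) (by norm_num) a62 a61 rfl rfl
  have a82 : eulerianNumber 8 2 = 4293 :=
    step (n := 7) (j := 1) (r := 6) (by norm_num) a72 a71 rfl rfl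
  have a92 : eulerianNumber 9 2 = 14608 :=
    step (n := 8) (j := 1) (r := 7) (by norm_num) a82 a81 rfl rfl
  have a33 : eulerianNumber 3 3 = 0 := eulerianNumber_eq_zero (n := 2) (j := 2) le_rfl
  have a43 : eulerianNumber 4 3 = 1 :=
    step (n := 3) (j := 2) (r := 1) (by norm_num) a33 a32 rfl rfl
  have a53 : eulerianNumber 5 3 = 26 :=
    step (n := 4) (j := 2) (r := 2) (by norm_num) a43 a42 rfl rfl
  have a63 : eulerianNumber 6 3 = 302 :=
    step (n := 5) (j := 2) (r := 3) (by norm_num) a53 a52 rfl rfl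
  have a73 : eulerianNumber 7 3 = 2416 :=
    step (n := 6) (j := 2) (r := 4) (by norm_num) a63 a62 rfl rfl
  have a83 : eulerianNumber 8 3 = 15619 :=
    step (n := 7) (j := 2) (r := 5) (by norm_num) a73 a72 rfl rfl
  have a93 : eulerianNumber 9 3 = 88234 :=
    step (n := 8) (j := 2) (r := 6) (by norm_num) a83 a82 rfl rfl
  have a44 : eulerianNumber 4 4 = 0 := eulerianNumber_eq_zero (n := 3) (j := 3) le_rfl
  have a54 : eulerianNumber 5 4 = 1 :=
    step (n := 4) (j := 3) (r := 1) (by norm_num) a44 a43 rfl rfl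
  have a64 : eulerianNumber 6 4 = 57 :=
    step (n := 5) (j := 3) (r := 2) (by norm_num) a54 a53 rfl rfl
  have a74 : eulerianNumber 7 4 = 1191 :=
    step (n := 6) (j := 3) (r := 3) (by norm_num) a64 a63 rfl rfl
  have a84 : eulerianNumber 8 4 = 15619 :=
    step (n := 7) (j := 3) (r := 4) (by norm_num) a74 a73 rfl rfl
  have a94 : eulerianNumber 9 4 = 156190 :=
    step (n := 8) (j := 3) (r := 5) (by norm_num) a84 a83 rfl rfl
  omega

theorem eulerianNumber_central_second_difference (s : ℕ) :
    eulerianNumber (2 * s + 9) (s + 4) + eulerianNumber (2 * s + 9) (s + 2)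
      < 2 * eulerianNumber (2 * s + 9) (s + 3) := by
  induction s with
  | zero =>
    simpa only [Nat.mul_zero, Nat.zero_add] using eulerianNumber_central_second_difference_nine
  | succ s ih =>
    have h1 := eulerianNumber_le_succ (2 * s + 8) (s + 1) (by omega)
    have h2 := eulerianNumber_le_succ (2 * s + 8) (s + 2) (by omega)
    -- Row 2s+10 has two equal middle entries, so the next centre is a multiple of one of them.
    have hs := eulerianNumber_symm (2 * s + 9) (s + 5) (s + 4) (by omega)
    have r5 : eulerianNumber (2 * (s + 1) + 9) (s + 1 + 4) =
        2 * (s + 6) * eulerianNumber (2 * s + 10) (s + 4) := by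
      rw [eulerianNumber_recurrence (n := 2 * s + 10) (i := s + 4) (r := s + 6) (by ring)
        (by omega) (by ring) (by ring), hs]
      ring
    rw [r5,
      eulerianNumber_recurrence (N := 2 * (s + 1) + 9) (n := 2 * s + 10) (j := s + 1 + 3)
        (i := s + 3) (r := s + 7) (by ring) (by omega) (by ring) (by ring),
      eulerianNumber_recurrence (N := 2 * (s + 1) + 9) (n := 2 * s + 10) (j := s + 1 + 2)
        (i := s + 2) (r := s + 8) (by ring) (by omega) (by ring) (by ring),
      show s + 1 + 3 = s + 4 by ring, show s + 1 + 2 = s + 3 by ring,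
      eulerianNumber_recurrence (N := 2 * s + 10) (n := 2 * s + 9) (j := s + 4)
        (i := s + 3) (r := s + 6) (by ring) (by omega) (by ring) (by ring),
      eulerianNumber_recurrence (N := 2 * s + 10) (n := 2 * s + 9) (j := s + 3)
        (i := s + 2) (r := s + 7) (by ring) (by omega) (by ring) (by ring),
      eulerianNumber_recurrence (N := 2 * s + 10) (n := 2 * s + 9) (j := s + 2)
        (i := s + 1) (r := s + 8) (by ring) (by omega) (by ring) (by ring)]
    exact second_difference_step h1 h2 ih

theorem proposition6p9 :
    ∃ M : ℕ, 3 ≤ M ∧ ∀ m : ℕ, M ≤ m →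
      (eulerianNumber (2 * m - 1) (m - 1) : ℤ)
        - 2 * (eulerianNumber (2 * m - 1) (m - 2) : ℤ)
        + (eulerianNumber (2 * m - 1) (m - 3) : ℤ) < 0 := by
  -- 5 is the least choice: at m = 4 the value is 2416 - 2·1191 + 120 = 154 > 0.
  refine ⟨5, by norm_num, fun m hm => ?_⟩
  obtain ⟨s, rfl⟩ := Nat.exists_eq_add_of_le' hm
  have h := eulerianNumber_central_second_difference s
  rw [show 2 * (s + 5) - 1 = 2 * s + 9 by omega, show s + 5 - 1 = s + 4 by omega,
    show s + 5 - 2 = s + 3 by omega, show s + 5 - 3 = s + 2 by omega]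
  omega
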